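/- **Platoon and its error dynamics.** Consider $N$ follower vehicles with error states $e_i(t)\in\mathbb{R}^3$ (location, velocity and acceleration error), disturbances $w_i(t)\in\mathbb{R}^3$ and performance outputs $z_i=e_i$, with closed-loop error dynamics $$\dot e_i=(A+B\bar L_{ii})e_i+\eta_i,\qquad \eta_i=\sum_{j=1}^N K_{ij}e_j+w_i,\qquad A=\begin{bmatrix}0&1&0\\0&0&1\\0&0&0\end{bmatrix},\quad B=\begin{bmatrix}0\\0\\1\end{bmatrix}.$$ Write $\mathrm{blk}(\kappa,\ell)$ for the $3\times3$ matrix with rows $(0,0,0)$, $(0,0,\kappa)$, $\ell\in\mathbb{R}^{1\times3}$. The coupling blocks come from the controller gains in one of two ways (fixed throughout). (I) Gains $\bar k_{ij}$ ($j\ne i$), $\bar k_{i0}\in\mathbb{R}$, $L_{ii}\in\mathbb{R}^{1\times3}$: $K_{ij}=\mathrm{blk}(-\bar k_{ij},0)$ for $j\neq i$, and $K_{ii}=\mathrm{blk}(\bar k_{i0}+\sum_{j\ne i}\bar k_{ij}-1,\,L_{ii})$; put $K_{i0}=\mathrm{blk}(\bar k_{i0}-1,L_{ii})$. (II) Gains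 $L_{ij}\in\mathbb{R}^{1\times 3}$: $K_{ij}=\mathrm{blk}(0,-L_{ij})$ for $j\ne i$, and $K_{ii}=\mathrm{blk}(0,L_{ii}+\sum_{j\neq i}L_{ij})$; put $K_{i0}=\mathrm{blk}(0,L_{ii})$. In both cases $K_{ii}=K_{i0}-\sum_{j\ne i}K_{ij}$. **$L_2$-stability.** A system $\dot x=f(x,u)$, $y=h(x,u)$ is finite-gain $L_2$-stable with $L_2$-gain $\gamma$ if it is equilibrium-independent dissipative with supply rate $\gamma^2|u|^2-|y|^2$: there is a $C^1$ function $V(x,x^*)$, with $V(x^*,x^*)=0$ and $V(x,x^*)>0$ for $x\ne x^*$, such that $\nabla_xV(x,x^*)f(x,u)\le\gamma^2|u-u^*|^2-|h(x,u)-h(x^*,u^*)|^2$ for all $x,u$ and all equilibria $x^*$ (states with a unique $u^*$ such that $f(x^*,u^*)=0$); and if moreover $\int_0^T|y|^2dt\le\gamma^2\int_0^T|u|^2dt+\beta(x(0))$ for all $T\ge0$ along all solutions with locally square integrable input, for some $\beta\ge0$ with $\beta(0)=0$. **Decentralized design.** Let $\bar\gamma>0$ and $\bar p_1,\dots,\bar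 p_N>0$ be prespecified. For $i=1,\dots,N$ in turn, vehicle $i$ does the following. 1. It chooses a solution $(\tilde L_{ii},P_i,\nu_i,\tilde\rho_i,\tilde\gamma_i)$ of the local LMI problem $$P_i>0,\quad\begin{bmatrix}\tilde\rho_iI&P_i&0\\P_i&-\mathcal H(AP_i+B\tilde L_{ii})&-I+\tfrac12P_i\\0&-I+\tfrac12P_i&-\nu_iI\end{bmatrix}>0,\quad-\frac{\tilde\gamma_i}{\bar p_i}<\nu_i<0,\quad0<\tilde\rho_i<\min\Big\{\bar p_i,\frac{4\tilde\gamma_i}{\bar p_i}\Big\},$$ where $\mathcal H(M)=M+M^\top$, and sets $\rho_i=1/\tilde\rho_i$, $\bar L_{ii}=\tilde L_{ii}P_i^{-1}$. 2. It chooses $p_i,\hat\gamma_i\in\mathbb{R}$ and $3\times 3$ blocks $Q_{ii}$ and $Q_{ij},Q_{ji}$ ($j<i$), feasible (in particular: optimal for any objective function) for $$p_i>0,\qquad\hat\gamma_i<\bar\gamma,\qquad\tilde W_{ii}>0,$$ where the $Q$-blocks have the structure of the $K$-blocks (in case I, $Q_{ii}=\mathrm{blk}(\kappa,\ell)$ and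 off-diagonal blocks $\mathrm{blk}(\kappa,0)$; in case II, all blocks $\mathrm{blk}(0,\ell)$). Here, with $\mathsf e_{ij}=1$ if $i=j$ and $0$ otherwise, $V_i=-p_i\nu_iI$, $R_i=-p_i\rho_iI$, $S_i=-\frac1{2\nu_i}I$, $$W_{ij}=\begin{bmatrix}\mathsf e_{ij}V_i&0&Q_{ij}&\mathsf e_{ij}V_i\\0&\mathsf e_{ij}I&\mathsf e_{ij}I&0\\Q_{ji}^\top&\mathsf e_{ij}I&-Q_{ji}^\top S_j-S_iQ_{ij}-\mathsf e_{ij}R_i&-\mathsf e_{ij}S_iV_i\\\mathsf e_{ij}V_i&0&-\mathsf e_{ij}V_iS_j&\hat\gamma_i\mathsf e_{ij}I\end{bmatrix},$$ and recursively $\tilde W_i=[\tilde W_{ij}]_{j<i}=[W_{ij}]_{j<i}(\mathcal D_i\mathcal A_i^\top)^{-1}$, $\tilde W_{ii}=W_{ii}-\tilde W_i\mathcal D_i\tilde W_i^\top$, with $\mathcal D_i=\mathrm{diag}(\tilde W_{jj}^{-1}:j<i)$ and $\mathcal A_i$ the block lower-triangular matrix formed from $[\tilde W_{kl}]_{k,l<i}$.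 It sets $K_{ii}=V_i^{-1}Q_{ii}$, and $K_{ij}=V_i^{-1}Q_{ij}$, $K_{ji}=V_j^{-1}Q_{ji}$ for $j<i$, and initializes $K_{i0}:=K_{ii}+\sum_{j<i}K_{ij}$. 3. The update $K_{j0}:=K_{j0}+K_{ji}$ is made at each earlier vehicle $j<i$ with $K_{ji}\neq0$. **Theorem.** Suppose that all the above problems are solved at the vehicles $1,\dots,N$. Then for every $n\le N$ (in particular $n=N$): (a) the blocks $K_{ij}$ ($i\ne j$) and $K_{i0}$, $i,j\le n$, held after step $n$ are those of exactly one choice of controller gains for the platoon of the vehicles $1,\dots,n$, and the coupling blocks that these gains produce, including the diagonal ones, are the designed blocks $K_{ij}$; (b) the closed-loop error dynamics of this platoon are finite-gain $L_2$-stable from $w$ to $z$ with some $L_2$-gain $\gamma>0$ with $\gamma^2<\bar\gamma$. Moreover, the design is compositional: for every $n$, whether the choices of the vehicles $1,\dots,n$ are feasible, and which controller gains result after step $n$, depends only on the choices of these vehicles. -/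

import Mathlib

namespace Platoon

open MeasureTheory Set

/-! ### Dynamic systems, equilibrium-independent dissipativity, `L₂`-gain -/

/-- A system `ẋ = f (x, u)`, `y = h (x, u)` with states in `ℝⁿ`, inputs in `ℝ^q`, outputs in `ℝᵐ`
(`n`, `q`, `m` are index types). -/
structure Sys (n q m : Type) where
  f : (n → ℝ) → (q → ℝ) → (n → ℝ)
  h : (n → ℝ) → (q → ℝ) → (m → ℝ)

section Systems

variable {n q m : Type} [Fintype n] [Fintype q] [Fintype m]

/-- The equilibrium states: those `x*` with exactly one `u*` such that `f (x*, u*) = 0`. -/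
def Sys.equilibria (S : Sys n q m) : Set (n → ℝ) :=
  {xs | ∃! us, S.f xs us = 0}

/-- Equilibrium-independent dissipativity (EID) under the supply rate `s`, with respect to all
equilibrium states. -/
def Sys.IsEID (S : Sys n q m) (s : (q → ℝ) → (m → ℝ) → ℝ) : Prop :=
  ∃ V : (n → ℝ) → (n → ℝ) → ℝ,
    ContDiffOn ℝ 1 (fun a : (n → ℝ) × (n → ℝ) => V a.1 a.2) (univ ×ˢ S.equilibria) ∧
    ∀ xs ∈ S.equilibria, ∀ us, S.f xs us = 0 →
      V xs xs = 0 ∧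
      (∀ x, x ≠ xs → 0 < V x xs) ∧
      ∀ x u, fderiv ℝ (fun x' => V x' xs) x (S.f x u) ≤ s (u - us) (S.h x u - S.h xs us)

/-- `X`-EID: EID under the quadratic supply rate with coefficient matrix `X`. -/
def Sys.IsXEID (S : Sys n q m) (X : Matrix (q ⊕ m) (q ⊕ m) ℝ) : Prop :=
  S.IsEID fun u y => Sum.elim u y ⬝ᵥ X.mulVec (Sum.elim u y)

/-- `x` is a (Carathéodory) solution on `[0, ∞)` for the input `u`. -/
structure Sys.IsSolution (S : Sys n q m) (x : ℝ → n → ℝ) (u : ℝ → q → ℝ) : Prop where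
  integrable : ∀ t, 0 ≤ t → ∀ i,
    IntervalIntegrable (fun s => S.f (x s) (u s) i) volume 0 t
  eq : ∀ t, 0 ≤ t → ∀ i, x t i = x 0 i + ∫ s in (0 : ℝ)..t, S.f (x s) (u s) i

/-- The input-output form of `L₂`-stability with `L₂`-gain at most `γ`: along every solution with a
locally square integrable input, `∫₀ᵀ |y|² ≤ γ² ∫₀ᵀ |u|² + β (x 0)`, with a bias `β ≥ 0` that depends
only on the initial state and vanishes at `0`. -/
def Sys.HasL2Gain (S : Sys n q m) (γ : ℝ) : Prop :=
  ∃ β : (n → ℝ) → ℝ, β 0 = 0 ∧ (∀ x₀, 0 ≤ β x₀) ∧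
    ∀ (x : ℝ → n → ℝ) (u : ℝ → q → ℝ), S.IsSolution x u →
      (∀ T, 0 ≤ T → ∀ i, MemLp (fun t => u t i) 2 (volume.restrict (Icc 0 T))) →
      ∀ T, 0 ≤ T →
        IntervalIntegrable (fun t => ∑ i, S.h (x t) (u t) i ^ 2) volume 0 T ∧
        ∫ t in (0 : ℝ)..T, ∑ i, S.h (x t) (u t) i ^ 2 ≤
          γ ^ 2 * (∫ t in (0 : ℝ)..T, ∑ i, u t i ^ 2) + β (x 0)

/-- Finite-gain `L₂`-stability with `L₂`-gain `γ`: `X`-EID for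
`X = [γ² I, 0; 0, -I]`, together with its input-output form. -/
def Sys.FiniteGainL2Stable [DecidableEq q] [DecidableEq m] (S : Sys n q m) (γ : ℝ) : Prop :=
  S.IsXEID (Matrix.fromBlocks (γ ^ 2 • 1) 0 0 (-1)) ∧ S.HasL2Gain γ

end Systems

/-! ### The platoon error dynamics -/

/-- `3 × 3` blocks; a vehicle error is `(location error, velocity error, acceleration error)`. -/
abbrev Blk := Matrix (Fin 3) (Fin 3) ℝ

def A : Blk := !![0, 1, 0; 0, 0, 1; 0, 0, 0]

def B : Matrix (Fin 3) (Fin 1) ℝ := !![0; 0; 1]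

/-- The block with entry `κ` in place (velocity, acceleration) and last row `l`. -/
def blk (κ : ℝ) (l : Fin 3 → ℝ) : Blk := !![0, 0, 0; 0, 0, κ; l 0, l 1, l 2]

/-- The two formulations of the error dynamics: `I` (location and velocity errors are weighted sums
over all vehicles) and `II` (all errors are relative to the leader). -/
inductive Formulation where
  | I
  | II

/-- Global controller gains under formulation I: weights `k̄ᵢⱼ`, weights `k̄ᵢ₀` of the leader, and
`Lᵢᵢ`. -/
@[ext]
structure GainsI (N : ℕ) where
  kbar : Fin N → Fin N → ℝ
  kbar_self : ∀ i, kbar i i = 0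
  kbar0 : Fin N → ℝ
  L : Fin N → Fin 3 → ℝ

/-- Global controller gains under formulation II: `uᵢ = Lᵢᵢ eᵢ + ∑_{j ≠ i} Lᵢⱼ (eᵢ - eⱼ)`. -/
@[ext]
structure GainsII (N : ℕ) where
  L : Fin N → Fin N → Fin 3 → ℝ

def Gains : Formulation → ℕ → Type
  | .I, N => GainsI N
  | .II, N => GainsII N

/-- The coefficients `kᵢᵢ = k̄ᵢ₀ + ∑ⱼ k̄ᵢⱼ` and `kᵢⱼ = -k̄ᵢⱼ` for `j ≠ i`. -/
def GainsI.k {N : ℕ} (c : GainsI N) (i j : Fin N) : ℝ :=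
  if i = j then c.kbar0 i + ∑ l, c.kbar i l else -c.kbar i j

/-- The rows `K̄ᵢᵢ = Lᵢᵢ + ∑_{j ≠ i} Lᵢⱼ` and `K̄ᵢⱼ = -Lᵢⱼ` for `j ≠ i`. -/
def GainsII.Kbar {N : ℕ} (c : GainsII N) (i j : Fin N) : Fin 3 → ℝ :=
  if i = j then c.L i i + ∑ l ∈ Finset.univ.erase i, c.L i l else -c.L i j

/-- The coupling blocks `Kᵢⱼ` of the closed-loop error dynamics that the gains produce. -/
def Gains.coupling {N : ℕ} : (φ : Formulation) → Gains φ N → Fin N → Fin N → Blk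
  | .I, c, i, j =>
      blk (GainsI.k c i j - if i = j then 1 else 0) (if i = j then GainsI.L c i else 0)
  | .II, c, i, j => blk 0 (GainsII.Kbar c i j)

/-- The block `Kᵢⱼ`, `i ≠ j`, that the gains of vehicle `i` for its link from `j` encode. -/
def Gains.link {N : ℕ} : (φ : Formulation) → Gains φ N → Fin N → Fin N → Blk
  | .I, c, i, j => blk (-GainsI.kbar c i j) 0
  | .II, c, i, j => blk 0 (-GainsII.L c i j)

/-- The block `Kᵢ₀` that the leader-related gains of vehicle `i` encode. -/
def Gains.leader {N : ℕ} : (φ : Formulation) → Gains φ N → Fin N → Blk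
  | .I, c, i => blk (GainsI.kbar0 c i - 1) (GainsI.L c i)
  | .II, c, i => blk 0 (GainsII.L c i i)

/-- The networked system `ėᵢ = (A + B L̄ᵢᵢ) eᵢ + ηᵢ`, `ηᵢ = ∑ⱼ Kᵢⱼ eⱼ + wᵢ`, `zᵢ = eᵢ`, with
disturbance input `w` and performance output `z`. -/
def errorDynamics {N : ℕ} (Lbar : Fin N → Matrix (Fin 1) (Fin 3) ℝ) (K : Fin N → Fin N → Blk) :
    Sys (Fin N × Fin 3) (Fin N × Fin 3) (Fin N × Fin 3) where
  f e w := fun a =>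
    (A + B * Lbar a.1).mulVec (fun s => e (a.1, s)) a.2 +
      (∑ j, (K a.1 j).mulVec (fun s => e (j, s)) a.2 + w a)
  h e _ := e

/-! ### The sequential decomposition of a symmetric block matrix -/

/-- The blocks `W̃ᵢⱼ`, `j ≤ i`, of a block matrix `W = [Wᵢⱼ]` (and `0` for `j > i`):
`W̃ᵢ = [W̃ᵢⱼ]_{j < i} = Wᵢ (Dᵢ Aᵢᵀ)⁻¹` and `W̃ᵢᵢ = Wᵢᵢ - W̃ᵢ Dᵢ W̃ᵢᵀ`, where `Wᵢ = [Wᵢⱼ]_{j < i}`,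
`Dᵢ = diag (W̃ⱼⱼ⁻¹ : j < i)`, and `Aᵢ` is the block lower-triangular matrix of `[W̃ₖₗ]_{k, l < i}`. -/
noncomputable def tilde {m : Type} [Fintype m] [DecidableEq m] (W : ℕ → ℕ → Matrix m m ℝ) (i : ℕ) :
    ℕ → Matrix m m ℝ :=
  let lowerTri : Matrix (Fin i × m) (Fin i × m) ℝ :=
    Matrix.comp _ _ _ _ ℝ (Matrix.of fun k l : Fin i => if l ≤ k then tilde W k l else 0)
  let D : Matrix (Fin i × m) (Fin i × m) ℝ :=
    Matrix.comp _ _ _ _ ℝ (Matrix.diagonal fun k : Fin i => (tilde W k k)⁻¹)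
  let Wi : Matrix m (Fin i × m) ℝ := Matrix.of fun r a => W i a.1 r a.2
  let Wt : Matrix m (Fin i × m) ℝ := Wi * (D * lowerTri.transpose)⁻¹
  fun j =>
    if hj : j < i then Matrix.of fun r s => Wt r (⟨j, hj⟩, s)
    else if j = i then W i i - Wt * D * Wt.transpose
    else 0
termination_by i
decreasing_by all_goals exact k.isLt

/-! ### The decentralized design -/

/-- The variables of the local controller design at one vehicle. -/
structure LocalVars where
  Ltil : Matrix (Fin 1) (Fin 3) ℝ
  P : Blk
  ν : ℝ
  ρtil : ℝ
  γtil : ℝ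

namespace LocalVars

/-- The passivity index `ρ = 1 / ρ̃`. -/
noncomputable def ρ (d : LocalVars) : ℝ := 1 / d.ρtil

/-- The local controller gain `L̄ = L̃ P⁻¹`. -/
noncomputable def Lbar (d : LocalVars) : Matrix (Fin 1) (Fin 3) ℝ := d.Ltil * d.P⁻¹

/-- The `3 × 3` array of `3 × 3` blocks of the local LMI. -/
noncomputable def lmiBlocks (d : LocalVars) : Matrix (Fin 3) (Fin 3) Blk :=
  !![d.ρtil • (1 : Blk), d.P, 0;
     d.P, -((A * d.P + B * d.Ltil) + (A * d.P + B * d.Ltil).transpose), -1 + (1 / 2 : ℝ) • d.P;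
     0, -1 + (1 / 2 : ℝ) • d.P, -d.ν • (1 : Blk)]

/-- The local LMI problem with prespecified parameter `p`. -/
structure Feasible (d : LocalVars) (p : ℝ) : Prop where
  P_pos : d.P.PosDef
  lmi_pos : (Matrix.comp _ _ _ _ ℝ d.lmiBlocks).PosDef
  ν_lower : -d.γtil / p < d.ν
  ν_neg : d.ν < 0
  ρtil_pos : 0 < d.ρtil
  ρtil_lt : d.ρtil < min p (4 * d.γtil / p)

end LocalVars

/-- The variables of the vehicle-by-vehicle design; vehicles are numbered `0, 1, 2, …`, and vehicle
`i` chooses `loc i`, `p i`, `γhat i`, `Q i i`, and `Q i j`, `Q j i` for `j < i`. -/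
structure Design where
  loc : ℕ → LocalVars
  Q : ℕ → ℕ → Blk
  p : ℕ → ℝ
  γhat : ℕ → ℝ

namespace Design

variable (D : Design)

/-- `V_p^{ii} = -pᵢ νᵢ I`. -/
def V (i : ℕ) : Blk := -(D.p i * (D.loc i).ν) • (1 : Blk)

/-- `R_p^{ii} = -pᵢ ρᵢ I`. -/
noncomputable def R (i : ℕ) : Blk := -(D.p i * (D.loc i).ρ) • (1 : Blk)

/-- `S_{ii} = -1 / (2 νᵢ) I`. -/
noncomputable def S (i : ℕ) : Blk := -(1 / (2 * (D.loc i).ν)) • (1 : Blk)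

/-- The `4 × 4` array of `3 × 3` blocks that makes up `Wᵢⱼ`. -/
noncomputable def Wblocks (i j : ℕ) : Matrix (Fin 4) (Fin 4) Blk :=
  let e : ℝ := if i = j then 1 else 0
  !![e • D.V i, 0, D.Q i j, e • D.V i;
     0, e • 1, e • 1, 0;
     (D.Q j i).transpose, e • 1,
       -((D.Q j i).transpose * D.S j) - D.S i * D.Q i j - e • D.R i, -(e • (D.S i * D.V i));
     e • D.V i, 0, -(e • (D.V i * D.S j)), (D.γhat i * e) • 1]

/-- The blocks `Wᵢⱼ`. -/
noncomputable def W (i j : ℕ) : Matrix (Fin 4 × Fin 3) (Fin 4 × Fin 3) ℝ :=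
  Matrix.comp _ _ _ _ ℝ (D.Wblocks i j)

/-- The blocks `Kᵢⱼ = (V_p^{ii})⁻¹ Qᵢⱼ`. -/
noncomputable def K (i j : ℕ) : Blk := (D.V i)⁻¹ * D.Q i j

/-- The zero pattern of the coupling blocks, `Q` having to share the structure of `[Kᵢⱼ]`. -/
def Structured (φ : Formulation) (i j : ℕ) : Prop :=
  match φ with
  | .I => if i = j then ∃ κ l, D.Q i j = blk κ l else ∃ κ, D.Q i j = blk κ 0
  | .II => ∃ l, D.Q i j = blk 0 l

/-- The choices of vehicle `i` solve its two design problems: the local LMI problem with the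
prespecified parameter `pbar`, and then the LMI problem for its coupling blocks. -/
structure StepFeasible (φ : Formulation) (pbar γbar : ℝ) (i : ℕ) : Prop where
  localLMI : (D.loc i).Feasible pbar
  structured_self : D.Structured φ i i
  structured : ∀ j < i, D.Structured φ i j ∧ D.Structured φ j i
  p_pos : 0 < D.p i
  γhat_lt : D.γhat i < γbar
  tilde_pos : (tilde D.W i i).PosDef

open Classical in
/-- The block `K_{j0}` held by vehicle `j` after the first `n` vehicles have been designed. When
vehicle `n` is designed, it initializes `K_{n0}` so that `K_{nn} = K_{n0} - ∑_{l < n} K_{nl}`, and the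
update `K_{j0} := K_{j0} + K_{jn}` is made at every earlier vehicle `j` that receives information
from vehicle `n`; nothing else changes. -/
noncomputable def leaderBlk : (n : ℕ) → (j : ℕ) → Blk
  | 0, _ => 0
  | n + 1, j =>
      if j = n then D.K n n + ∑ l ∈ Finset.range n, D.K n l
      else if j < n ∧ D.K j n ≠ 0 then leaderBlk n j + D.K j n
      else leaderBlk n j

/-- The gains `c` of a platoon of `n` vehicles encode the blocks held after `n` design steps. -/
structure Realizes (φ : Formulation) (n : ℕ) (c : Gains φ n) : Prop where
  link : ∀ i j : Fin n, i ≠ j → Gains.link φ c i j = D.K i j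
  leader : ∀ i : Fin n, Gains.leader φ c i = D.leaderBlk n i

/-- The closed-loop error dynamics of the platoon of the first `n` vehicles with global controller
gains `c` and the designed local controller gains. -/
noncomputable def closedLoop (φ : Formulation) (n : ℕ) (c : Gains φ n) :
    Sys (Fin n × Fin 3) (Fin n × Fin 3) (Fin n × Fin 3) :=
  errorDynamics (fun i => (D.loc i).Lbar) (Gains.coupling φ c)

/-- Two designs make the same choices at the first `n` vehicles. -/
structure AgreeOn (D' : Design) (n : ℕ) : Prop where
  loc : ∀ i < n, D.loc i = D'.loc i
  Q : ∀ i < n, ∀ j < n, D.Q i j = D'.Q i j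
  p : ∀ i < n, D.p i = D'.p i
  γhat : ∀ i < n, D.γhat i = D'.γhat i

end Design

end Platoon

/-!
The recursion for `W̃` is a block `L D Lᵀ` decomposition, so positive definiteness of all the
diagonal blocks `W̃ₖₖ` makes `W = [Wᵢⱼ]` positive definite. The local LMI at vehicle `i` says that
`eᵢᵀ Pᵢ⁻¹ eᵢ` is a storage function for the supply rate `-νᵢ |ηᵢ|² + ηᵢ · eᵢ - ρᵢ |eᵢ|²`, and
`W > 0` says that the sum of these supply rates with weights `pᵢ` is at most
`∑ᵢ (γ̂ᵢ |wᵢ|² - |eᵢ|²)` once `ηᵢ = ∑ⱼ Kᵢⱼ eⱼ + wᵢ`. Hence `∑ᵢ pᵢ eᵢᵀ Pᵢ⁻¹ eᵢ` is a storage function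
for `L₂`-gain `γ` as soon as `γ²` dominates all `γ̂ᵢ`. The gains are recovered from the blocks since
`K_{i0} = ∑ⱼ Kᵢⱼ` holds after every step, which is how the leader gains enter `Kᵢᵢ`.
-/

namespace Platoon

open Matrix MeasureTheory Set

section BlockMatrix

variable {I J R : Type*} [Fintype I] [Fintype J]

/-- The block row `[u₁ u₂ ⋯]`, for rows `𝒲ᵢ` of blocks that are not part of a square array. -/
def blockRow {I m p R : Type*} (u : I → Matrix m p R) : Matrix m (I × p) R :=
  of fun r a => u a.1 r a.2

theorem blockRow_injective {I m p R : Type*} :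
    Function.Injective (blockRow : (I → Matrix m p R) → Matrix m (I × p) R) := fun _ _ h =>
  funext fun i => ext fun r s => congrFun₂ h r (i, s)

theorem blockRow_mul_comp [Semiring R] (u : I → Matrix J J R) (M : Matrix I I (Matrix J J R)) :
    blockRow u * comp I I J J R M = blockRow (u ᵥ* M) := by
  ext r ⟨i, s⟩
  simp only [blockRow, Matrix.mul_apply, Fintype.sum_prod_type, of_apply, comp_apply, vecMul,
    dotProduct, Matrix.sum_apply]

theorem blockRow_mul_transpose [CommSemiring R] (u v : I → Matrix J J R) :
    blockRow u * (blockRow v)ᵀ = ∑ i, u i * (v i)ᵀ := by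
  ext r s
  simp only [blockRow, Matrix.mul_apply, Fintype.sum_prod_type, of_apply, transpose_apply,
    Matrix.sum_apply]

theorem dotProduct_comp_mulVec [CommRing R] (M : Matrix I I (Matrix J J R)) (x y : I × J → R) :
    x ⬝ᵥ comp I I J J R M *ᵥ y =
      ∑ i, ∑ j, (fun s => x (i, s)) ⬝ᵥ M i j *ᵥ fun s => y (j, s) := by
  simp only [dotProduct, mulVec, Fintype.sum_prod_type, comp_apply, Finset.mul_sum]
  exact Finset.sum_congr rfl fun i _ => Finset.sum_comm

theorem isUnit_comp_of_lowerTriangular [LinearOrder I] [DecidableEq J] [CommRing R]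
    {M : Matrix I I (Matrix J J R)} (hM : ∀ i j, i < j → M i j = 0)
    (hd : ∀ i, IsUnit (M i i)) : IsUnit (comp I I J J R M) := by
  have htri : (comp I I J J R M)ᵀ.BlockTriangular Prod.fst := by
    rintro ⟨i, r⟩ ⟨j, s⟩ (hij : j < i)
    simp [hM j i hij]
  rw [← isUnit_transpose, isUnit_iff_isUnit_det, htri.det_fintype, IsUnit.prod_univ_iff]
  intro i
  let e : J ≃ {a : I × J // a.1 = i} :=
    ⟨fun r => ⟨(i, r), rfl⟩, fun a => a.1.2, fun _ => rfl, by rintro ⟨⟨_, r⟩, rfl⟩; rfl⟩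
  have hblock : ((comp I I J J R M)ᵀ.toSquareBlock Prod.fst i).submatrix e e = (M i i)ᵀ := rfl
  rw [← det_submatrix_equiv_self e, hblock, det_transpose]
  exact (isUnit_iff_isUnit_det _).1 (hd i)

variable [DecidableEq I]

theorem dotProduct_comp_diagonal_mulVec [CommRing R] (d : I → Matrix J J R) (x y : I × J → R) :
    x ⬝ᵥ comp I I J J R (diagonal d) *ᵥ y =
      ∑ i, (fun s => x (i, s)) ⬝ᵥ d i *ᵥ fun s => y (i, s) := by
  rw [dotProduct_comp_mulVec]
  refine Finset.sum_congr rfl fun i _ => ?_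
  rw [Finset.sum_eq_single i (fun j _ hj => by simp [diagonal_apply_ne _ hj.symm]) (by simp),
    diagonal_apply_eq]

theorem posDef_comp_diagonal {I J : Type*} [Finite I] [DecidableEq I] [Finite J]
    {d : I → Matrix J J ℝ} (hd : ∀ i, (d i).PosDef) :
    (comp I I J J ℝ (diagonal d)).PosDef := by
  have := Fintype.ofFinite I
  have := Fintype.ofFinite J
  refine .of_dotProduct_mulVec_pos ?_ fun {x} hx => ?_
  · ext ⟨i, r⟩ ⟨j, s⟩
    obtain rfl | h := eq_or_ne i j
    · simpa using (hd i).isHermitian.apply r s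
    · simp [diagonal_apply_ne _ h, diagonal_apply_ne' _ h]
  · rw [star_trivial, dotProduct_comp_diagonal_mulVec]
    obtain ⟨⟨i, s⟩, his⟩ := Function.ne_iff.1 hx
    refine Finset.sum_pos' (fun j _ => ?_) ⟨i, Finset.mem_univ i, ?_⟩
    · simpa using (hd j).posSemidef.dotProduct_mulVec_nonneg fun s => x (j, s)
    · simpa using (hd i).dotProduct_mulVec_pos (x := fun s => x (i, s)) fun h => his (congrFun h s)

theorem isUnit_comp_diagonal [DecidableEq J] [Semiring R] {d : I → Matrix J J R}
    (hd : ∀ i, IsUnit (d i)) : IsUnit (comp I I J J R (diagonal d)) :=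
  (isUnit_comp_iff ..).2 ((Pi.isUnit_iff.2 hd).map (diagonalRingHom I (Matrix J J R)))

end BlockMatrix

section SequentialDecomposition

variable {m : Type} [Fintype m] [DecidableEq m] {W W' : ℕ → ℕ → Matrix m m ℝ}

theorem tilde_of_lt {i j : ℕ} (h : i < j) : tilde W i j = 0 := by
  rw [tilde]
  simp [h.not_gt, h.ne']

theorem tilde_congr {n : ℕ} (h : ∀ i < n, ∀ j < n, W i j = W' i j) (i : ℕ) (hi : i < n) :
    tilde W i = tilde W' i := by
  induction i using Nat.strong_induction_on with
  | _ i ih =>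
    have ih' (k : Fin i) : tilde W k = tilde W' k := ih k k.2 (k.2.trans hi)
    have hW (k : Fin i) : W i k = W' i k := h i hi k (k.2.trans hi)
    rw [tilde, tilde]
    simp only [ih', hW, h i hi i hi]

variable (W) in
/-- The block lower-triangular matrix `𝒜ₙ` of the blocks `W̃ₖₗ`, `k, l < n`. -/
noncomputable def tildeTri (n : ℕ) : Matrix (Fin n × m) (Fin n × m) ℝ :=
  comp _ _ _ _ ℝ (of fun k l : Fin n => tilde W k l)

variable (W) in
/-- The block diagonal matrix `𝒟ₙ` of the inverse pivots `W̃ₖₖ⁻¹`, `k < n`. -/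
noncomputable def tildeDiag (n : ℕ) : Matrix (Fin n × m) (Fin n × m) ℝ :=
  comp _ _ _ _ ℝ (diagonal fun k : Fin n => (tilde W k k)⁻¹)

theorem tilde_eq (i j : ℕ) : tilde W i j =
    let Wt := blockRow (fun k : Fin i => W i k) * (tildeDiag W i * (tildeTri W i)ᵀ)⁻¹
    if hj : j < i then of fun r s => Wt r (⟨j, hj⟩, s)
    else if j = i then W i i - Wt * tildeDiag W i * Wtᵀ else 0 := by
  have hL : tildeTri W i =
      comp _ _ _ _ ℝ (of fun k l : Fin i => if l ≤ k then tilde W k l else 0) := by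
    refine congrArg _ (ext fun k l => ?_)
    rw [of_apply, of_apply]
    split_ifs with h
    · rfl
    · exact tilde_of_lt (not_le.1 h)
  rw [tilde, hL]
  rfl

theorem blockRow_tilde (i : ℕ) : blockRow (fun k : Fin i => tilde W i k) =
    blockRow (fun k : Fin i => W i k) * (tildeDiag W i * (tildeTri W i)ᵀ)⁻¹ := by
  ext r ⟨k, s⟩
  simp only [blockRow, of_apply, tilde_eq i k, k.2, dite_true]

theorem tilde_self (i : ℕ) : tilde W i i = W i i - blockRow (fun k : Fin i => tilde W i k) *
    tildeDiag W i * (blockRow fun k : Fin i => tilde W i k)ᵀ := by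
  rw [tilde_eq, blockRow_tilde]
  simp only [lt_irrefl, dite_false, if_true]

theorem blockRow_mul_tildeDiag {n : ℕ} (u : Fin n → Matrix m m ℝ) :
    blockRow u * tildeDiag W n = blockRow fun k => u k * (tilde W k k)⁻¹ := by
  rw [tildeDiag, blockRow_mul_comp]
  exact congrArg blockRow (funext fun k => vecMul_diagonal _ _ k)

theorem self_eq_sum_tilde (i : ℕ) :
    W i i = ∑ k : Fin i, tilde W i k * (tilde W k k)⁻¹ * (tilde W i k)ᵀ + tilde W i i := by
  rw [← blockRow_mul_transpose, ← blockRow_mul_tildeDiag]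
  exact eq_add_of_sub_eq' (tilde_self i).symm

theorem eq_sum_tilde_of_lt {i j : ℕ} (hT : ∀ k < i, IsUnit (tilde W k k)) (hj : j < i) :
    W i j = ∑ k : Fin i, tilde W i k * (tilde W k k)⁻¹ * (tilde W j k)ᵀ := by
  have hD : IsUnit (tildeDiag W i) := isUnit_comp_diagonal fun k => by
    simpa using hT k k.2
  have hL : IsUnit (tildeTri W i)ᵀ := (isUnit_transpose _).2 <|
    isUnit_comp_of_lowerTriangular (fun _ _ h => tilde_of_lt h) fun k => hT k k.2
  have hrow : blockRow (fun k : Fin i => W i k) =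
      blockRow (fun k : Fin i => tilde W i k) * tildeDiag W i * (tildeTri W i)ᵀ := by
    rw [blockRow_tilde, Matrix.mul_assoc _ (tildeDiag W i), Matrix.mul_assoc,
      nonsing_inv_mul _ ((isUnit_iff_isUnit_det _).1 (hD.mul hL)), Matrix.mul_one]
  rw [blockRow_mul_tildeDiag, tildeTri, transpose_comp, blockRow_mul_comp] at hrow
  exact congrFun (blockRow_injective hrow) ⟨j, hj⟩

theorem eq_sum_tilde_of_le {i j : ℕ} (hT : ∀ k ≤ i, (tilde W k k).PosDef) (hj : j ≤ i) :
    W i j = ∑ k ∈ Finset.range (i + 1), tilde W i k * (tilde W k k)⁻¹ * (tilde W j k)ᵀ := by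
  rw [Finset.sum_range_succ, Finset.sum_range]
  obtain rfl | hj := hj.eq_or_lt
  · have hdet : IsUnit (tilde W j j).det := (isUnit_iff_isUnit_det _).1 (hT j le_rfl).isUnit
    rw [mul_nonsing_inv _ hdet, Matrix.one_mul, (isHermitian_iff_isSymm.1 (hT j le_rfl).1).eq]
    exact self_eq_sum_tilde j
  · rw [tilde_of_lt hj, transpose_zero, Matrix.mul_zero, add_zero]
    exact eq_sum_tilde_of_lt (fun k hk => (hT k hk.le).isUnit) hj

theorem comp_eq_tildeTri_mul_tildeDiag_mul {n : ℕ} (hW : ∀ i j, (W i j)ᵀ = W j i)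
    (hT : ∀ k < n, (tilde W k k).PosDef) :
    comp _ _ _ _ ℝ (of fun i j : Fin n => W i j) =
      tildeTri W n * tildeDiag W n * (tildeTri W n)ᵀ := by
  let F (i j : ℕ) := ∑ k ∈ Finset.range n, tilde W i k * (tilde W k k)⁻¹ * (tilde W j k)ᵀ
  have hF (i j : ℕ) : (F i j)ᵀ = F j i := by
    rw [transpose_sum]
    refine Finset.sum_congr rfl fun k hk => ?_
    have hk := (isHermitian_iff_isSymm.1 (hT k (Finset.mem_range.1 hk)).1).eq
    rw [transpose_mul, transpose_mul, transpose_transpose, transpose_nonsing_inv, hk,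
      Matrix.mul_assoc]
  have hle {i j : ℕ} (hi : i < n) (hj : j ≤ i) : W i j = F i j := by
    rw [eq_sum_tilde_of_le (fun k hk => hT k (hk.trans_lt hi)) hj]
    refine Finset.sum_subset (Finset.range_subset_range.2 hi) fun k _ hk => ?_
    rw [tilde_of_lt (i := i) (by simpa [Nat.lt_succ_iff] using hk), Matrix.zero_mul,
      Matrix.zero_mul]
  have hWF (i j : Fin n) : W i j = F i j := by
    obtain h | h := le_total j i
    · exact hle i.2 h
    · rw [← hW, ← hF, hle j.2 h]
  rw [tildeTri, tildeDiag, transpose_comp]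
  simp only [← compRingEquiv_apply, ← map_mul]
  refine congrArg _ (ext fun i j => ?_)
  rw [of_apply, hWF, Matrix.mul_apply]
  simp only [F, mul_diagonal, Finset.sum_range, of_apply, map_apply, transpose_apply]

theorem posDef_comp_of_tilde_posDef {n : ℕ} (hW : ∀ i j, (W i j)ᵀ = W j i)
    (hT : ∀ k < n, (tilde W k k).PosDef) :
    (comp _ _ _ _ ℝ (of fun i j : Fin n => W i j)).PosDef := by
  have hL : IsUnit (tildeTri W n) :=
    isUnit_comp_of_lowerTriangular (fun _ _ h => tilde_of_lt h) fun k => (hT k k.2).isUnit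
  rw [comp_eq_tildeTri_mul_tildeDiag_mul hW hT, ← conjTranspose_eq_transpose_of_trivial]
  exact (Matrix.IsUnit.posDef_star_right_conjugate_iff hL).2
    (posDef_comp_diagonal fun k => (hT k k.2).inv)

end SequentialDecomposition

section IndefiniteIntegral

/-- `x` is an indefinite integral of the integrable function `f` on the interval between `a` and
`b`; this is the sense in which the components of a Carathéodory solution solve their equations. -/
structure IsIndefiniteIntegral (x f : ℝ → ℝ) (a b : ℝ) : Prop where
  intervalIntegrable : IntervalIntegrable f volume a b
  eq : ∀ t ∈ uIcc a b, x t = x a + ∫ s in a..t, f s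

namespace IsIndefiniteIntegral

variable {x y f g : ℝ → ℝ} {a b : ℝ}

theorem mono_right (h : IsIndefiniteIntegral x f a b) {t : ℝ} (ht : t ∈ uIcc a b) :
    IsIndefiniteIntegral x f a t :=
  have hsub := uIcc_subset_uIcc_left ht
  ⟨h.intervalIntegrable.mono_set hsub, fun s hs => h.eq s (hsub hs)⟩

theorem absolutelyContinuousOnInterval (h : IsIndefiniteIntegral x f a b) :
    AbsolutelyContinuousOnInterval (fun t => x a + ∫ s in a..t, f s) a b :=
  (contDiff_const.contDiffOn (s := uIcc a b)).absolutelyContinuousOnInterval.fun_add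
    (h.intervalIntegrable.absolutelyContinuousOnInterval_intervalIntegral left_mem_uIcc)

theorem continuousOn (h : IsIndefiniteIntegral x f a b) : ContinuousOn x (uIcc a b) :=
  h.absolutelyContinuousOnInterval.continuousOn.congr h.eq

theorem integral_mul_add_mul (hx : IsIndefiniteIntegral x f a b)
    (hy : IsIndefiniteIntegral y g a b) :
    ∫ t in a..b, (f t * y t + x t * g t) = x b * y b - x a * y a := by
  have parts := hx.absolutelyContinuousOnInterval.integral_deriv_mul_eq_sub
    hy.absolutelyContinuousOnInterval
  simp only [← hx.eq b right_mem_uIcc, ← hy.eq b right_mem_uIcc, intervalIntegral.integral_same,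
    add_zero] at parts
  rw [← parts]
  refine intervalIntegral.integral_congr_ae ?_
  filter_upwards [hx.intervalIntegrable.ae_hasDerivAt_integral,
    hy.intervalIntegrable.ae_hasDerivAt_integral] with t hf hg ht
  have ht := uIoc_subset_uIcc ht
  rw [((hf ht a left_mem_uIcc).const_add (x a)).deriv,
    ((hg ht a left_mem_uIcc).const_add (y a)).deriv, hx.eq t ht, hy.eq t ht]

theorem mul (hx : IsIndefiniteIntegral x f a b) (hy : IsIndefiniteIntegral y g a b) :
    IsIndefiniteIntegral (fun t => x t * y t) (fun t => f t * y t + x t * g t) a b where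
  intervalIntegrable := (hx.intervalIntegrable.mul_continuousOn hy.continuousOn).add
    (hy.intervalIntegrable.continuousOn_mul hx.continuousOn)
  eq t ht := by
    rw [(hx.mono_right ht).integral_mul_add_mul (hy.mono_right ht), add_sub_cancel]

theorem const_mul (h : IsIndefiniteIntegral x f a b) (c : ℝ) :
    IsIndefiniteIntegral (fun t => c * x t) (fun t => c * f t) a b where
  intervalIntegrable := h.intervalIntegrable.const_mul c
  eq t ht := by rw [h.eq t ht, mul_add, intervalIntegral.integral_const_mul]

theorem sum {ι : Type*} {s : Finset ι} {x f : ι → ℝ → ℝ}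
    (h : ∀ i ∈ s, IsIndefiniteIntegral (x i) (f i) a b) :
    IsIndefiniteIntegral (fun t => ∑ i ∈ s, x i t) (fun t => ∑ i ∈ s, f i t) a b where
  intervalIntegrable := by
    simpa only [Finset.sum_fn] using
      IntervalIntegrable.sum s fun i hi => (h i hi).intervalIntegrable
  eq t ht := by
    rw [intervalIntegral.integral_finsetSum fun i hi =>
      ((h i hi).mono_right ht).intervalIntegrable, ← Finset.sum_add_distrib]
    exact Finset.sum_congr rfl fun i hi => (h i hi).eq t ht

theorem dotProduct_mulVec {n : Type*} [Fintype n] {x f : ℝ → n → ℝ}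
    (h : ∀ i, IsIndefiniteIntegral (fun t => x t i) (fun t => f t i) a b) {M : Matrix n n ℝ}
    (hM : M.IsSymm) :
    IsIndefiniteIntegral (fun t => x t ⬝ᵥ M *ᵥ x t) (fun t => 2 * (x t ⬝ᵥ M *ᵥ f t)) a b := by
  have hMx (i : n) : IsIndefiniteIntegral (fun t => (M *ᵥ x t) i) (fun t => (M *ᵥ f t) i) a b :=
    sum fun j _ => (h j).const_mul (M i j)
  have key := sum (s := Finset.univ) fun i _ => (h i).mul (hMx i)
  simp only [Finset.sum_add_distrib] at key
  have hV : (fun t => 2 * (x t ⬝ᵥ M *ᵥ f t)) =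
      fun t => f t ⬝ᵥ M *ᵥ x t + x t ⬝ᵥ M *ᵥ f t := by
    funext t
    rw [two_mul, ← dotProduct_transpose_mulVec M (f t), hM.eq]
  rw [hV]
  exact key

end IsIndefiniteIntegral

end IndefiniteIntegral

section QuadraticStorage

variable {n q m : Type} {S : Sys n q m}

theorem Sys.IsSolution.isIndefiniteIntegral {x : ℝ → n → ℝ} {u : ℝ → q → ℝ}
    (h : S.IsSolution x u) {T : ℝ} (hT : 0 ≤ T) (i : n) :
    IsIndefiniteIntegral (fun t => x t i) (fun t => S.f (x t) (u t) i) 0 T where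
  intervalIntegrable := h.integrable T hT i
  eq t ht := h.eq t (by rw [uIcc_of_le hT] at ht; exact ht.1) i

variable [Fintype n] {M : Matrix n n ℝ}

theorem fderiv_dotProduct_mulVec (hM : M.IsSymm) (x v : n → ℝ) :
    fderiv ℝ (fun y => y ⬝ᵥ M *ᵥ y) x v = 2 * (x ⬝ᵥ M *ᵥ v) := by
  classical
  have h := (toBilin' M).toContinuousBilinearMap.hasFDerivAt_of_bilinear
    (hasFDerivAt_id x) (hasFDerivAt_id x)
  have hB (y z : n → ℝ) : (toBilin' M).toContinuousBilinearMap y z = y ⬝ᵥ M *ᵥ z :=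
    toBilin'_apply' M y z
  simp only [id, hB] at h
  rw [h.fderiv, two_mul]
  have hvx : v ⬝ᵥ M *ᵥ x = x ⬝ᵥ M *ᵥ v := by rw [← dotProduct_transpose_mulVec, hM.eq]
  simp only [_root_.add_apply, ContinuousLinearMap.precompR_apply,
    ContinuousLinearMap.precompL_apply, ContinuousLinearMap.compL_apply,
    ContinuousLinearMap.comp_apply, ContinuousLinearMap.id_apply, hB, hvx]

theorem Sys.isEID_of_quadratic (hM : M.PosDef) {s : (q → ℝ) → (m → ℝ) → ℝ}
    (hdiss : ∀ x u xs us, S.f xs us = 0 →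
      2 * ((x - xs) ⬝ᵥ M *ᵥ S.f x u) ≤ s (u - us) (S.h x u - S.h xs us)) :
    S.IsEID s := by
  refine ⟨fun x xs => (x - xs) ⬝ᵥ M *ᵥ (x - xs), ?_, fun xs _ us hus => ⟨by simp, ?_, ?_⟩⟩
  · simp only [dotProduct, mulVec, Pi.sub_apply]
    fun_prop
  · intro x hx
    simpa using hM.dotProduct_mulVec_pos (sub_ne_zero.2 hx)
  · intro x u
    rw [fderiv_comp_sub (f := fun y => y ⬝ᵥ M *ᵥ y),
      fderiv_dotProduct_mulVec (isHermitian_iff_isSymm.1 hM.1)]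
    exact hdiss x u xs us hus

variable [Fintype q] [Fintype m] {γ : ℝ}

theorem Sys.hasL2Gain_of_quadratic (hM : M.PosSemidef) {g : (n → ℝ) → m → ℝ}
    (hg : Continuous g) (hh : ∀ x u, S.h x u = g x)
    (hdiss : ∀ x u, 2 * (x ⬝ᵥ M *ᵥ S.f x u) ≤ γ ^ 2 * ∑ i, u i ^ 2 - ∑ i, g x i ^ 2) :
    S.HasL2Gain γ := by
  have hnn (x : n → ℝ) : 0 ≤ x ⬝ᵥ M *ᵥ x := by simpa using hM.dotProduct_mulVec_nonneg x
  refine ⟨fun x => x ⬝ᵥ M *ᵥ x, by simp, hnn, fun x u hxu hu T hT => ?_⟩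
  simp only [hh]
  have hx := hxu.isIndefiniteIntegral hT
  have hV := IsIndefiniteIntegral.dotProduct_mulVec hx (isHermitian_iff_isSymm.1 hM.1)
  have hu2 : IntervalIntegrable (fun t => ∑ i, u t i ^ 2) volume 0 T := by
    rw [intervalIntegrable_iff_integrableOn_Icc_of_le hT]
    exact integrable_finsetSum _ fun i _ => (hu T hT i).integrable_sq
  have hy2 : IntervalIntegrable (fun t => ∑ i, g (x t) i ^ 2) volume 0 T := by
    have hgx := hg.comp_continuousOn (continuousOn_pi.2 fun i => (hx i).continuousOn)
    exact (continuousOn_finsetSum _ fun i _ =>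
      ((continuous_apply i).comp_continuousOn hgx).pow 2).intervalIntegrable
  refine ⟨hy2, ?_⟩
  have hle := intervalIntegral.integral_mono hT hV.intervalIntegrable
    ((hu2.const_mul (γ ^ 2)).sub hy2) fun t => hdiss (x t) (u t)
  rw [intervalIntegral.integral_sub (hu2.const_mul _) hy2,
    intervalIntegral.integral_const_mul (γ ^ 2)] at hle
  linarith [hV.eq T right_mem_uIcc, hnn (x T)]

theorem dotProduct_l2Supply_mulVec [DecidableEq q] [DecidableEq m] (u : q → ℝ) (y : m → ℝ) :
    Sum.elim u y ⬝ᵥ fromBlocks (γ ^ 2 • 1) 0 0 (-1) *ᵥ Sum.elim u y =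
      γ ^ 2 * ∑ i, u i ^ 2 - ∑ i, y i ^ 2 := by
  rw [fromBlocks_mulVec, Sum.elim_comp_inl, Sum.elim_comp_inr, sumElim_dotProduct_sumElim]
  simp only [smul_mulVec, neg_mulVec, one_mulVec, zero_mulVec, add_zero, zero_add,
    dotProduct_smul, dotProduct_neg, smul_eq_mul]
  simp only [dotProduct, pow_two, sub_eq_add_neg]

theorem Sys.finiteGainL2Stable_of_linear [DecidableEq q] [DecidableEq m] (hM : M.PosDef)
    (hf : ∀ x xs u us, S.f (x - xs) (u - us) = S.f x u - S.f xs us)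
    {g : (n → ℝ) →ₗ[ℝ] m → ℝ} (hh : ∀ x u, S.h x u = g x)
    (hdiss : ∀ x u, 2 * (x ⬝ᵥ M *ᵥ S.f x u) ≤ γ ^ 2 * ∑ i, u i ^ 2 - ∑ i, g x i ^ 2) :
    S.FiniteGainL2Stable γ := by
  refine ⟨S.isEID_of_quadratic hM fun x u xs us hus => ?_,
    S.hasL2Gain_of_quadratic hM.posSemidef g.continuous_of_finiteDimensional hh hdiss⟩
  rw [dotProduct_l2Supply_mulVec, hh, hh, ← map_sub, ← sub_zero (S.f x u), ← hus, ← hf]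
  exact hdiss (x - xs) (u - us)

end QuadraticStorage

section Gains

theorem blk_inj {κ κ' : ℝ} {l l' : Fin 3 → ℝ} : blk κ l = blk κ' l' ↔ κ = κ' ∧ l = l' := by
  refine ⟨fun h => ⟨by simpa [blk] using congrFun₂ h 1 2, funext fun s => ?_⟩,
    by rintro ⟨rfl, rfl⟩; rfl⟩
  have := congrFun₂ h 2 s
  fin_cases s <;> simpa [blk] using this

theorem smul_blk (c κ : ℝ) (l : Fin 3 → ℝ) : c • blk κ l = blk (c * κ) (c • l) := by
  ext r s
  fin_cases r <;> fin_cases s <;> simp [blk]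

theorem sum_blk {ι : Type*} (s : Finset ι) (κ : ι → ℝ) (l : ι → Fin 3 → ℝ) :
    ∑ i ∈ s, blk (κ i) (l i) = blk (∑ i ∈ s, κ i) (∑ i ∈ s, l i) := by
  ext r t
  rw [Matrix.sum_apply]
  fin_cases r <;> fin_cases t <;> simp [blk]

variable {φ : Formulation} {n : ℕ}

theorem GainsI.sum_k (c : GainsI n) (i : Fin n) : ∑ j, c.k i j = c.kbar0 i := by
  have hk (j : Fin n) : c.k i j = (if i = j then c.kbar0 i + ∑ l, c.kbar i l else 0) -
      c.kbar i j := by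
    obtain rfl | hij := eq_or_ne i j
    · simp [GainsI.k, c.kbar_self]
    · simp [GainsI.k, hij]
  simp only [hk, Finset.sum_sub_distrib, Finset.sum_ite_eq, Finset.mem_univ, if_true,
    add_sub_cancel_right]

theorem GainsII.sum_Kbar (c : GainsII n) (i : Fin n) : ∑ j, c.Kbar i j = c.L i i := by
  rw [← Finset.add_sum_erase _ _ (Finset.mem_univ i), GainsII.Kbar, if_pos rfl,
    add_assoc, add_eq_left, ← Finset.sum_add_distrib]
  refine Finset.sum_eq_zero fun j hj => ?_
  rw [GainsII.Kbar, if_neg (Finset.ne_of_mem_erase hj).symm, add_neg_cancel]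

namespace Gains

theorem coupling_of_ne (c : Gains φ n) {i j : Fin n} (hij : i ≠ j) :
    coupling φ c i j = link φ c i j := by
  cases φ <;> simp [coupling, link, GainsI.k, GainsII.Kbar, hij]

theorem sum_coupling (c : Gains φ n) (i : Fin n) : ∑ j, coupling φ c i j = leader φ c i := by
  cases φ with
  | I => simpa [coupling, leader, sum_blk, blk_inj] using GainsI.sum_k c i
  | II => simpa [coupling, leader, sum_blk, blk_inj] using GainsII.sum_Kbar c i

theorem coupling_eq_iff (c : Gains φ n) (K : Fin n → Fin n → Blk) :
    (∀ i j, coupling φ c i j = K i j) ↔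
      (∀ i j, i ≠ j → link φ c i j = K i j) ∧ ∀ i, leader φ c i = ∑ j, K i j := by
  refine ⟨fun h => ⟨fun i j hij => by rw [← coupling_of_ne c hij, h], fun i => ?_⟩,
    fun ⟨hlink, hleader⟩ => ?_⟩
  · simp only [← sum_coupling, h]
  · have hne (i j : Fin n) (hij : i ≠ j) : coupling φ c i j = K i j :=
      (coupling_of_ne c hij).trans (hlink i j hij)
    refine fun i j => (eq_or_ne i j).elim (fun hij => hij ▸ ?_) (hne i j)
    have hsum := (sum_coupling c i).trans (hleader i)
    rw [← Finset.add_sum_erase _ _ (Finset.mem_univ i),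
      ← Finset.add_sum_erase _ (K i) (Finset.mem_univ i),
      Finset.sum_congr rfl fun k hk => hne i k (Finset.ne_of_mem_erase hk).symm] at hsum
    exact add_right_cancel hsum

theorem ext_link_leader {c c' : Gains φ n}
    (hlink : ∀ i j, i ≠ j → link φ c i j = link φ c' i j)
    (hleader : ∀ i, leader φ c i = leader φ c' i) : c = c' := by
  cases φ with
  | I =>
    refine GainsI.ext (funext₂ fun i j => ?_) (funext fun i => ?_) (funext fun i => ?_)
    · obtain rfl | hij := eq_or_ne i j
      · exact (GainsI.kbar_self c i).trans (GainsI.kbar_self c' i).symm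
      · exact neg_inj.1 (blk_inj.1 (hlink i j hij)).1
    · exact sub_left_inj.1 (blk_inj.1 (hleader i)).1
    · exact (blk_inj.1 (hleader i)).2
  | II =>
    refine GainsII.ext (funext₂ fun i j => ?_)
    obtain rfl | hij := eq_or_ne i j
    · exact (blk_inj.1 (hleader i)).2
    · exact neg_inj.1 (blk_inj.1 (hlink i j hij)).2

theorem coupling_injective :
    Function.Injective (coupling φ : Gains φ n → Fin n → Fin n → Blk) := fun c c' h =>
  ext_link_leader
    (fun i j hij => by rw [← coupling_of_ne c hij, h, coupling_of_ne c' hij])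
    (fun i => by rw [← sum_coupling, h, sum_coupling])

theorem exists_coupling_I_eq (κ : Fin n → Fin n → ℝ) (l : Fin n → Fin 3 → ℝ) :
    ∃ c : Gains .I n, ∀ i j, coupling .I c i j = blk (κ i j) (if i = j then l i else 0) := by
  let c : GainsI n :=
    { kbar := fun i j => if i = j then 0 else -κ i j
      kbar_self := fun i => if_pos rfl
      kbar0 := fun i => ∑ j, κ i j + 1
      L := l }
  refine ⟨c, (coupling_eq_iff (φ := .I) c _).2 ⟨fun i j hij => ?_, fun i => ?_⟩⟩
  · simp [link, c, hij]
  · simp [leader, c, sum_blk]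

theorem exists_coupling_II_eq (l : Fin n → Fin n → Fin 3 → ℝ) :
    ∃ c : Gains .II n, ∀ i j, coupling .II c i j = blk 0 (l i j) := by
  let c : GainsII n := ⟨fun i j => if i = j then ∑ k, l i k else -l i j⟩
  refine ⟨c, (coupling_eq_iff (φ := .II) c _).2 ⟨fun i j hij => ?_, fun i => ?_⟩⟩
  · simp [link, c, hij]
  · simp [leader, c, sum_blk]

end Gains

namespace Design

variable {D D' : Design} {pbar : ℕ → ℝ} {γbar : ℝ}

theorem K_eq_smul (i j : ℕ) : D.K i j = (-(D.p i * (D.loc i).ν))⁻¹ • D.Q i j := by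
  have hV : (D.V i)⁻¹ = (-(D.p i * (D.loc i).ν))⁻¹ • (1 : Blk) := by
    rw [V]
    obtain h | h := eq_or_ne (-(D.p i * (D.loc i).ν)) 0
    · rw [h, zero_smul, Matrix.inv_zero, _root_.inv_zero, zero_smul]
    · exact inv_eq_left_inv (by rw [smul_mul_smul_comm, inv_mul_cancel₀ h, one_smul, one_mul])
  rw [K, hV, smul_mul_assoc, one_mul]

theorem structured_of_stepFeasible (hD : ∀ i < n, D.StepFeasible φ (pbar i) γbar i) {i j : ℕ}
    (hi : i < n) (hj : j < n) : D.Structured φ i j := by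
  obtain h | rfl | h := lt_trichotomy i j
  · exact ((hD j hj).structured i h).2
  · exact (hD i hi).structured_self
  · exact ((hD i hi).structured j h).1

theorem exists_coupling_eq_K (h : ∀ i < n, ∀ j < n, D.Structured φ i j) :
    ∃ c : Gains φ n, Gains.coupling φ c = fun i j : Fin n => D.K i j := by
  have hs (i j : Fin n) : D.Structured φ i j := h i i.2 j j.2
  simp only [K_eq_smul, funext_iff]
  cases φ with
  | I =>
    have hQ (i j : Fin n) : ∃ κ l, D.Q i j = blk κ (if i = j then l else 0) := by
      obtain rfl | hij := eq_or_ne i j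
      · simpa [Structured] using hs i i
      · simpa [Structured, hij, Fin.val_inj] using hs i j
    choose κ l hQ using hQ
    obtain ⟨c, hc⟩ := Gains.exists_coupling_I_eq
      (fun i j : Fin n => (-(D.p i * (D.loc i).ν))⁻¹ * κ i j)
      (fun i : Fin n => (-(D.p i * (D.loc i).ν))⁻¹ • l i i)
    refine ⟨c, fun i j => ?_⟩
    rw [hc, hQ, smul_blk]
    obtain rfl | hij := eq_or_ne i j
    · simp
    · simp [hij]
  | II =>
    choose l hQ using hs
    obtain ⟨c, hc⟩ := Gains.exists_coupling_II_eq
      (fun i j : Fin n => (-(D.p i * (D.loc i).ν))⁻¹ • l i j)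
    exact ⟨c, fun i j => by rw [hc, hQ, smul_blk, mul_zero]⟩

theorem leaderBlk_eq_sum {j : ℕ} (hj : j < n) :
    D.leaderBlk n j = ∑ l ∈ Finset.range n, D.K j l := by
  induction n with
  | zero => exact absurd hj (Nat.not_lt_zero _)
  | succ n ih =>
    rw [leaderBlk, Finset.sum_range_succ]
    obtain rfl | hjn := (Nat.lt_succ_iff.1 hj).eq_or_lt
    · rw [if_pos rfl, add_comm]
    · rw [if_neg hjn.ne, ih hjn, ite_eq_left_iff]
      intro hK
      rw [not_not.1 fun h => hK ⟨hjn, h⟩, add_zero]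

theorem realizes_iff_coupling_eq {c : Gains φ n} :
    D.Realizes φ n c ↔ ∀ i j : Fin n, Gains.coupling φ c i j = D.K i j := by
  have hleader (i : Fin n) : D.leaderBlk n i = ∑ j : Fin n, D.K i j := by
    rw [leaderBlk_eq_sum i.2, Finset.sum_range]
  rw [Gains.coupling_eq_iff c fun i j => D.K i j]
  simp only [← hleader]
  exact ⟨fun h => ⟨h.link, h.leader⟩, fun h => ⟨h.1, h.2⟩⟩

theorem existsUnique_realizes (h : ∀ i < n, ∀ j < n, D.Structured φ i j) :
    ∃! c : Gains φ n, D.Realizes φ n c := by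
  simpa only [realizes_iff_coupling_eq, funext_iff] using
    Gains.coupling_injective.existsUnique_of_mem_range (exists_coupling_eq_K h)

namespace AgreeOn

theorem symm (h : D.AgreeOn D' n) : D'.AgreeOn D n :=
  ⟨fun i hi => (h.loc i hi).symm, fun i hi j hj => (h.Q i hi j hj).symm,
    fun i hi => (h.p i hi).symm, fun i hi => (h.γhat i hi).symm⟩

theorem K_eq (h : D.AgreeOn D' n) {i j : ℕ} (hi : i < n) (hj : j < n) : D.K i j = D'.K i j := by
  rw [K, K, V, V, h.loc i hi, h.p i hi, h.Q i hi j hj]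

theorem W_eq (h : D.AgreeOn D' n) {i j : ℕ} (hi : i < n) (hj : j < n) : D.W i j = D'.W i j := by
  simp only [W, Wblocks, V, R, S, h.loc i hi, h.loc j hj, h.p i hi, h.Q i hi j hj, h.Q j hj i hi,
    h.γhat i hi]

theorem structured_iff (h : D.AgreeOn D' n) {i j : ℕ} (hi : i < n) (hj : j < n) :
    D.Structured φ i j ↔ D'.Structured φ i j := by
  simp only [Structured, h.Q i hi j hj]

theorem stepFeasible {p : ℝ} {i : ℕ} (h : D.AgreeOn D' n) (hi : i < n)
    (hD : D.StepFeasible φ p γbar i) : D'.StepFeasible φ p γbar i where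
  localLMI := h.loc i hi ▸ hD.localLMI
  structured_self := (h.structured_iff hi hi).1 hD.structured_self
  structured j hj := ⟨(h.structured_iff hi (hj.trans hi)).1 (hD.structured j hj).1,
    (h.structured_iff (hj.trans hi) hi).1 (hD.structured j hj).2⟩
  p_pos := h.p i hi ▸ hD.p_pos
  γhat_lt := h.γhat i hi ▸ hD.γhat_lt
  tilde_pos := tilde_congr (fun _ hi _ hj => h.W_eq hi hj) i hi ▸ hD.tilde_pos

theorem stepFeasible_iff {p : ℝ} {i : ℕ} (h : D.AgreeOn D' n) (hi : i < n) :
    D.StepFeasible φ p γbar i ↔ D'.StepFeasible φ p γbar i :=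
  ⟨h.stepFeasible hi, h.symm.stepFeasible hi⟩

theorem realizes_iff (h : D.AgreeOn D' n) {c : Gains φ n} :
    D.Realizes φ n c ↔ D'.Realizes φ n c := by
  have hK (i j : Fin n) : D.K i j = D'.K i j := h.K_eq i.2 j.2
  simp only [realizes_iff_coupling_eq, hK]

end AgreeOn

end Design

end Gains

section Dissipation

theorem two_mul_dotProduct_le_of_passivity_lmi {ι : Type*} [Fintype ι] [DecidableEq ι]
    {P H : Matrix ι ι ℝ} {ρ ρtil ν : ℝ} (hP : P.IsSymm) (hρ : ρtil * ρ = 1)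
    (hLMI : (comp _ _ _ _ ℝ
      !![ρtil • (1 : Matrix ι ι ℝ), P, 0;
         P, -(H + Hᵀ), -1 + (1 / 2 : ℝ) • P;
         0, -1 + (1 / 2 : ℝ) • P, -ν • (1 : Matrix ι ι ℝ)]).PosSemidef) (y η : ι → ℝ) :
    2 * (y ⬝ᵥ (H *ᵥ y + η)) ≤
      -ν * (η ⬝ᵥ η) + η ⬝ᵥ P *ᵥ y - ρ * (P *ᵥ y ⬝ᵥ P *ᵥ y) := by
  -- The first component carries out the Schur complement with respect to the block `ρ̃ I`.
  have key := hLMI.dotProduct_mulVec_nonneg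
    (fun a : Fin 3 × ι => (![-ρ • P *ᵥ y, y, η] : Fin 3 → ι → ℝ) a.1 a.2)
  have hyP (z : ι → ℝ) : y ⬝ᵥ P *ᵥ z = z ⬝ᵥ P *ᵥ y := by
    rw [← dotProduct_transpose_mulVec, hP.eq]
  rw [star_trivial, dotProduct_comp_mulVec] at key
  simp only [Fin.sum_univ_three, of_apply, cons_val_zero, cons_val_one, cons_val, smul_mulVec,
    one_mulVec, zero_mulVec, neg_mulVec, add_mulVec, dotProduct_add, dotProduct_neg,
    dotProduct_smul, smul_dotProduct, mulVec_smul, hyP, dotProduct_transpose_mulVec,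
    dotProduct_zero, smul_eq_mul, neg_smul, neg_dotProduct, mulVec_neg,
    dotProduct_comm y η] at key
  have hρx : ρtil * (ρ * (ρ * (P *ᵥ y ⬝ᵥ P *ᵥ y))) = ρ * (P *ᵥ y ⬝ᵥ P *ᵥ y) := by
    rw [← mul_assoc, hρ, one_mul]
  rw [dotProduct_add, dotProduct_comm y η]
  linarith

theorem LocalVars.Feasible.two_mul_dotProduct_le {d : LocalVars} {p : ℝ} (h : d.Feasible p)
    (x η : Fin 3 → ℝ) :
    2 * (x ⬝ᵥ d.P⁻¹ *ᵥ ((A + B * d.Lbar) *ᵥ x + η)) ≤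
      -d.ν * (η ⬝ᵥ η) + η ⬝ᵥ x - d.ρ * (x ⬝ᵥ x) := by
  have hP : d.P.IsSymm := isHermitian_iff_isSymm.1 h.P_pos.1
  have hdet : IsUnit d.P.det := (isUnit_iff_isUnit_det _).1 h.P_pos.isUnit
  have hPx : d.P *ᵥ d.P⁻¹ *ᵥ x = x := by
    rw [mulVec_mulVec, mul_nonsing_inv _ hdet, one_mulVec]
  have hcl : (A * d.P + B * d.Ltil) *ᵥ d.P⁻¹ *ᵥ x = (A + B * d.Lbar) *ᵥ x := by
    rw [mulVec_mulVec, Matrix.add_mul, Matrix.mul_assoc A, mul_nonsing_inv _ hdet, Matrix.mul_one,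
      LocalVars.Lbar, Matrix.mul_assoc]
  have hx (z : Fin 3 → ℝ) : x ⬝ᵥ d.P⁻¹ *ᵥ z = d.P⁻¹ *ᵥ x ⬝ᵥ z := by
    rw [← dotProduct_transpose_mulVec, transpose_nonsing_inv, hP.eq, dotProduct_comm]
  have key := two_mul_dotProduct_le_of_passivity_lmi hP
    (mul_one_div_cancel h.ρtil_pos.ne') h.lmi_pos.posSemidef (d.P⁻¹ *ᵥ x) η
  rwa [hPx, hcl, ← hx] at key

theorem errorDynamics_f_apply {N : ℕ} (Lbar : Fin N → Matrix (Fin 1) (Fin 3) ℝ)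
    (K : Fin N → Fin N → Blk) (e w : Fin N × Fin 3 → ℝ) (i : Fin N) :
    (fun s => (errorDynamics Lbar K).f e w (i, s)) = (A + B * Lbar i) *ᵥ (fun s => e (i, s)) +
      (∑ j, K i j *ᵥ (fun s => e (j, s)) + fun s => w (i, s)) := by
  funext s
  simp [errorDynamics]

theorem errorDynamics_f_sub {N : ℕ} (Lbar : Fin N → Matrix (Fin 1) (Fin 3) ℝ)
    (K : Fin N → Fin N → Blk) (e es w ws : Fin N × Fin 3 → ℝ) :
    (errorDynamics Lbar K).f (e - es) (w - ws) =
      (errorDynamics Lbar K).f e w - (errorDynamics Lbar K).f es ws := by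
  have hsub (j : Fin N) :
      (fun s => (e - es) (j, s)) = (fun s => e (j, s)) - fun s => es (j, s) := rfl
  funext a
  simp only [errorDynamics, hsub, mulVec_sub]
  simp only [Pi.sub_apply, Finset.sum_sub_distrib]
  ring

theorem exists_sq_lt_forall_le_sq {ι : Type*} [Finite ι] {f : ι → ℝ} {b : ℝ} (hb : 0 < b)
    (hf : ∀ i, f i < b) : ∃ γ : ℝ, 0 < γ ∧ γ ^ 2 < b ∧ ∀ i, f i ≤ γ ^ 2 := by
  obtain ⟨c, ⟨hc₀, hcb⟩, hfc⟩ : ∃ c ∈ Ioo 0 b, ∀ i, f i < c :=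
    ((Filter.Eventually.and (Ioo_mem_nhdsLT hb) <| Filter.eventually_all.2 fun i =>
      Filter.eventually_of_mem (Ioo_mem_nhdsLT (hf i)) fun _ h => h.1)).exists
  refine ⟨√c, Real.sqrt_pos.2 hc₀, ?_⟩
  rw [Real.sq_sqrt hc₀.le]
  exact ⟨hcb, fun i => (hfc i).le⟩

/-- The vector `(-η, -x, x, w)` at which the quadratic form of `[Wᵢⱼ]` is evaluated, for the input
`η`, the state `x` and the disturbance `w` of a vehicle. It is chosen so that the coupling terms
`Qᵢⱼ xⱼ` of a vehicle add up to `Vᵢ (ηᵢ - wᵢ)`. -/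
def certificateVec (η x w : Fin 3 → ℝ) : Fin 4 × Fin 3 → ℝ :=
  fun a => (![-η, -x, x, w] : Fin 4 → Fin 3 → ℝ) a.1 a.2

theorem certificateVec_dotProduct_comp_mulVec (M : Matrix (Fin 4) (Fin 4) Blk)
    (η x w η' x' w' : Fin 3 → ℝ) :
    certificateVec η x w ⬝ᵥ comp _ _ _ _ ℝ M *ᵥ certificateVec η' x' w' =
      ∑ a, ∑ b, ![-η, -x, x, w] a ⬝ᵥ M a b *ᵥ ![-η', -x', x', w'] b :=
  dotProduct_comp_mulVec M _ _

namespace Design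

variable {D : Design} {φ : Formulation} {pbar : ℕ → ℝ} {γbar : ℝ} {n : ℕ}

theorem transpose_W (i j : ℕ) : (D.W i j)ᵀ = D.W j i := by
  have hblocks (a b : Fin 4) : (D.Wblocks i j a b)ᵀ = D.Wblocks j i b a := by
    obtain rfl | hij := eq_or_ne i j
    · fin_cases a <;> fin_cases b <;>
        simp [Wblocks, V, S, R, sub_eq_add_neg, add_comm, smul_comm (D.p i * (D.loc i).ν)]
    · fin_cases a <;> fin_cases b <;>
        simp [Wblocks, V, S, R, hij, hij.symm, sub_eq_add_neg, add_comm]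
  ext ⟨a, r⟩ ⟨b, s⟩
  exact congrFun₂ (hblocks b a) r s

theorem dotProduct_W_mulVec_of_ne {i j : ℕ} (hij : i ≠ j) (η x w η' x' w' : Fin 3 → ℝ) :
    certificateVec η x w ⬝ᵥ D.W i j *ᵥ certificateVec η' x' w' =
      -((η - (1 / (2 * (D.loc i).ν)) • x) ⬝ᵥ D.Q i j *ᵥ x') -
        (η' - (1 / (2 * (D.loc j).ν)) • x') ⬝ᵥ D.Q j i *ᵥ x := by
  rw [W, certificateVec_dotProduct_comp_mulVec]
  simp only [Wblocks, hij, ↓reduceIte, V, neg_smul, smul_neg, zero_smul, neg_zero, S, one_div,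
    _root_.mul_inv_rev, mul_neg, Algebra.mul_smul_comm, mul_one, neg_neg, neg_mul,
    Algebra.smul_mul_assoc, one_mul, sub_neg_eq_add, R, sub_zero, mul_zero, of_apply, cons_val',
    cons_val_fin_one, Fin.sum_univ_four, cons_val_zero, mulVec_neg, dotProduct_neg, cons_val_one,
    cons_val, zero_mulVec, dotProduct_zero, add_zero, neg_dotProduct, zero_add,
    dotProduct_transpose_mulVec, add_mulVec, smul_mulVec, dotProduct_add, dotProduct_smul,
    smul_eq_mul, sub_dotProduct, smul_dotProduct, neg_sub]
  ring

theorem dotProduct_W_self_mulVec (i : ℕ) (η x w : Fin 3 → ℝ) :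
    certificateVec η x w ⬝ᵥ D.W i i *ᵥ certificateVec η x w =
      -(2 * ((η - (1 / (2 * (D.loc i).ν)) • x) ⬝ᵥ D.Q i i *ᵥ x)) -
        D.p i * (D.loc i).ν * (η ⬝ᵥ η - 2 * (η ⬝ᵥ w)) - x ⬝ᵥ x + D.p i * (D.loc i).ρ * (x ⬝ᵥ x) -
        2 * (1 / (2 * (D.loc i).ν) * (D.p i * (D.loc i).ν)) * (x ⬝ᵥ w) +
        D.γhat i * (w ⬝ᵥ w) := by
  rw [W, certificateVec_dotProduct_comp_mulVec]
  simp only [Wblocks, ↓reduceIte, V, neg_smul, smul_neg, one_smul, S, one_div,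
    _root_.mul_inv_rev, mul_neg, Algebra.mul_smul_comm, mul_one, neg_neg, neg_mul,
    Algebra.smul_mul_assoc, one_mul, sub_neg_eq_add, R, of_apply, cons_val', cons_val_fin_one,
    Fin.sum_univ_four, cons_val_zero, mulVec_neg, dotProduct_neg, cons_val_one, cons_val,
    neg_mulVec, smul_mulVec, one_mulVec, dotProduct_smul, neg_dotProduct, smul_eq_mul,
    zero_mulVec, dotProduct_zero, neg_zero, add_zero, zero_add, add_neg_cancel,
    dotProduct_transpose_mulVec, add_mulVec, dotProduct_add, dotProduct_comm w, smul_dotProduct,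
    zero_dotProduct, sub_dotProduct]
  ring

theorem sum_Q_mulVec {i : ℕ} (hpν : D.p i * (D.loc i).ν ≠ 0) (x : Fin n → Fin 3 → ℝ) :
    ∑ j : Fin n, D.Q i j *ᵥ x j = -(D.p i * (D.loc i).ν) • ∑ j : Fin n, D.K i j *ᵥ x j := by
  simp only [Finset.smul_sum, K_eq_smul, smul_mulVec, smul_inv_smul₀ (neg_ne_zero.2 hpν)]

theorem sum_certificate_nonneg (hT : ∀ k < n, (tilde D.W k k).PosDef)
    (η x w : Fin n → Fin 3 → ℝ) :
    0 ≤ ∑ i : Fin n,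
      (-(2 * ∑ j : Fin n, (η i - (1 / (2 * (D.loc i).ν)) • x i) ⬝ᵥ D.Q i j *ᵥ x j) +
        (D.γhat i * (w i ⬝ᵥ w i) - x i ⬝ᵥ x i + D.p i * (D.loc i).ρ * (x i ⬝ᵥ x i) -
          D.p i * (D.loc i).ν * (η i ⬝ᵥ η i - 2 * (η i ⬝ᵥ w i)) -
          2 * (1 / (2 * (D.loc i).ν) * (D.p i * (D.loc i).ν)) * (x i ⬝ᵥ w i))) := by
  let q (i j : Fin n) : ℝ := (η i - (1 / (2 * (D.loc i).ν)) • x i) ⬝ᵥ D.Q i j *ᵥ x j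
  let d (i : Fin n) : ℝ :=
    D.γhat i * (w i ⬝ᵥ w i) - x i ⬝ᵥ x i + D.p i * (D.loc i).ρ * (x i ⬝ᵥ x i) -
      D.p i * (D.loc i).ν * (η i ⬝ᵥ η i - 2 * (η i ⬝ᵥ w i)) -
      2 * (1 / (2 * (D.loc i).ν) * (D.p i * (D.loc i).ν)) * (x i ⬝ᵥ w i)
  have entry (i j : Fin n) : certificateVec (η i) (x i) (w i) ⬝ᵥ
      D.W i j *ᵥ certificateVec (η j) (x j) (w j) =
        -q i j - q j i + if i = j then d i else 0 := by
    obtain rfl | hij := eq_or_ne i j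
    · rw [dotProduct_W_self_mulVec, if_pos rfl]
      ring
    · rw [dotProduct_W_mulVec_of_ne (Fin.val_ne_of_ne hij), if_neg hij, add_zero]
  change 0 ≤ ∑ i, (-(2 * ∑ j, q i j) + d i)
  have key := (posDef_comp_of_tilde_posDef transpose_W hT).posSemidef.dotProduct_mulVec_nonneg
    (fun a => certificateVec (η a.1) (x a.1) (w a.1) a.2)
  rw [star_trivial, dotProduct_comp_mulVec] at key
  simpa only [of_apply, entry, Finset.sum_add_distrib, Finset.sum_sub_distrib,
    Finset.sum_neg_distrib, Finset.sum_comm (f := fun i j => q j i), Finset.sum_ite_eq,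
    Finset.mem_univ, if_true, ← Finset.mul_sum, two_mul, neg_add, sub_eq_add_neg] using key

theorem sum_supply_le (hpν : ∀ i : Fin n, D.p i * (D.loc i).ν ≠ 0)
    (hT : ∀ k < n, (tilde D.W k k).PosDef) {x w η : Fin n → Fin 3 → ℝ}
    (hη : ∀ i : Fin n, η i = ∑ j : Fin n, D.K i j *ᵥ x j + w i) :
    ∑ i : Fin n,
        D.p i * (-(D.loc i).ν * (η i ⬝ᵥ η i) + η i ⬝ᵥ x i - (D.loc i).ρ * (x i ⬝ᵥ x i)) ≤
      ∑ i : Fin n, (D.γhat i * (w i ⬝ᵥ w i) - x i ⬝ᵥ x i) := by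
  rw [← sub_nonneg, ← Finset.sum_sub_distrib]
  refine (sum_certificate_nonneg hT η x w).trans_eq (Finset.sum_congr rfl fun i _ => ?_)
  have hq : ∑ j : Fin n, (η i - (1 / (2 * (D.loc i).ν)) • x i) ⬝ᵥ D.Q i j *ᵥ x j =
      -(D.p i * (D.loc i).ν) *
        ((η i - (1 / (2 * (D.loc i).ν)) • x i) ⬝ᵥ (η i - w i)) := by
    rw [← dotProduct_sum, sum_Q_mulVec (hpν i), eq_sub_of_add_eq (hη i).symm, dotProduct_smul,
      smul_eq_mul]
  have hν : (D.loc i).ν ≠ 0 := right_ne_zero_of_mul (hpν i)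
  rw [hq]
  simp only [sub_dotProduct, dotProduct_sub, smul_dotProduct, smul_eq_mul,
    dotProduct_comm (x i) (η i)]
  field_simp
  ring

theorem two_mul_dotProduct_errorDynamics_le
    (hD : ∀ i < n, D.StepFeasible φ (pbar i) γbar i) {γ : ℝ}
    (hγ : ∀ i : Fin n, D.γhat i ≤ γ ^ 2) (e w : Fin n × Fin 3 → ℝ) :
    2 * (e ⬝ᵥ comp _ _ _ _ ℝ (diagonal fun i : Fin n => D.p i • (D.loc i).P⁻¹) *ᵥ
        (errorDynamics (fun i : Fin n => (D.loc i).Lbar) fun i j => D.K i j).f e w) ≤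
      γ ^ 2 * ∑ a, w a ^ 2 - ∑ a, e a ^ 2 := by
  let x (i : Fin n) : Fin 3 → ℝ := fun s => e (i, s)
  let v (i : Fin n) : Fin 3 → ℝ := fun s => w (i, s)
  let η (i : Fin n) : Fin 3 → ℝ := ∑ j : Fin n, D.K i j *ᵥ x j + v i
  have hdiss (i : Fin n) :
      2 * (x i ⬝ᵥ (D.p i • (D.loc i).P⁻¹) *ᵥ ((A + B * (D.loc i).Lbar) *ᵥ x i + η i)) ≤
        D.p i * (-(D.loc i).ν * (η i ⬝ᵥ η i) + η i ⬝ᵥ x i - (D.loc i).ρ * (x i ⬝ᵥ x i)) := by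
    rw [smul_mulVec, dotProduct_smul, smul_eq_mul, mul_left_comm]
    exact mul_le_mul_of_nonneg_left ((hD i i.2).localLMI.two_mul_dotProduct_le _ _)
      (hD i i.2).p_pos.le
  have hsupply := sum_supply_le
    (fun i => mul_ne_zero (hD i i.2).p_pos.ne' (hD i i.2).localLMI.ν_neg.ne)
    (fun k hk => (hD k hk).tilde_pos) (η := η) fun _ => rfl
  have hsq (u : Fin n × Fin 3 → ℝ) (i : Fin n) :
      (fun s => u (i, s)) ⬝ᵥ (fun s => u (i, s)) = ∑ s, u (i, s) ^ 2 := by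
    simp only [dotProduct, pow_two]
  rw [dotProduct_comp_diagonal_mulVec, Finset.mul_sum]
  simp only [errorDynamics_f_apply]
  refine (Finset.sum_le_sum fun i _ => hdiss i).trans (hsupply.trans ?_)
  rw [Fintype.sum_prod_type, Fintype.sum_prod_type, Finset.mul_sum, ← Finset.sum_sub_distrib]
  simp only [← hsq]
  exact Finset.sum_le_sum fun i _ => sub_le_sub_right
    (mul_le_mul_of_nonneg_right (hγ i) (Finset.sum_nonneg fun _ _ => mul_self_nonneg _)) _

theorem finiteGainL2Stable_closedLoop (hD : ∀ i < n, D.StepFeasible φ (pbar i) γbar i)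
    {c : Gains φ n} (hc : D.Realizes φ n c) {γ : ℝ} (hγ : ∀ i : Fin n, D.γhat i ≤ γ ^ 2) :
    (D.closedLoop φ n c).FiniteGainL2Stable γ := by
  have hK : Gains.coupling φ c = fun i j : Fin n => D.K i j :=
    funext₂ (realizes_iff_coupling_eq.1 hc)
  rw [closedLoop, hK]
  exact Sys.finiteGainL2Stable_of_linear
    (posDef_comp_diagonal fun i : Fin n =>
      (hD i i.2).localLMI.P_pos.inv.smul (hD i i.2).p_pos)
    (errorDynamics_f_sub _ _) (g := LinearMap.id) (fun _ _ => rfl)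
    (two_mul_dotProduct_errorDynamics_le hD hγ)

end Design

end Dissipation

end Platoon

theorem theorem3 (φ : Platoon.Formulation) (N : ℕ) (γbar : ℝ) (hγbar : 0 < γbar)
    (pbar : ℕ → ℝ) (hpbar : ∀ i < N, 0 < pbar i)
    (D : Platoon.Design) (hD : ∀ i < N, D.StepFeasible φ (pbar i) γbar i) :
    -- after each of the `N` design steps, the platoon designed so far is `L₂`-stable
    (∀ n ≤ N,
      (∃! c : Platoon.Gains φ n, D.Realizes φ n c) ∧
      ∀ c : Platoon.Gains φ n, D.Realizes φ n c →
        (∀ i j : Fin n, Platoon.Gains.coupling φ c i j = D.K i j) ∧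
        ∃ γ : ℝ, 0 < γ ∧ γ ^ 2 < γbar ∧ (D.closedLoop φ n c).FiniteGainL2Stable γ) ∧
    -- the design of the first `n` vehicles does not depend on the choices of later vehicles
    (∀ (D' : Platoon.Design) (n : ℕ), D.AgreeOn D' n →
      (∀ i < n, D.StepFeasible φ (pbar i) γbar i ↔ D'.StepFeasible φ (pbar i) γbar i) ∧
      ∀ c : Platoon.Gains φ n, D.Realizes φ n c ↔ D'.Realizes φ n c) := by
  refine ⟨fun n hn => ?_, fun D' n h => ⟨fun i hi => h.stepFeasible_iff hi,
    fun c => h.realizes_iff⟩⟩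
  have hDn : ∀ i < n, D.StepFeasible φ (pbar i) γbar i := fun i hi => hD i (hi.trans_le hn)
  refine ⟨Platoon.Design.existsUnique_realizes fun i hi j hj =>
    Platoon.Design.structured_of_stepFeasible hDn hi hj, fun c hc =>
    ⟨Platoon.Design.realizes_iff_coupling_eq.1 hc, ?_⟩⟩
  obtain ⟨γ, hγ, hγlt, hle⟩ :=
    Platoon.exists_sq_lt_forall_le_sq hγbar fun i : Fin n => (hDn i i.2).γhat_lt
  exact ⟨γ, hγ, hγlt, Platoon.Design.finiteGainL2Stable_closedLoop hDn hc hle⟩
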